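/- Let $\Gamma$ be an arithmetic subgroup of $\mathrm{SL}_2$, i.e. a subgroup of $\mathrm{SL}_2(\mathbb{Q})$ such that $\Gamma\cap \mathrm{SL}_2(\mathbb{Z})$ has finite index both in $\Gamma$ and in $\mathrm{SL}_2(\mathbb{Z})$. For every integer $a\ge 1$ let $\Gamma(a)$ be the subgroup of those matrices in $\Gamma\cap\mathrm{GL}_2(\mathbb{Z})$ which are congruent to the identity modulo $a$. Then: (1) $\mathrm{SL}_2$ does not satisfy the congruence subgroup property (CS): there is a subgroup $\Gamma'\subset\Gamma$ of finite index that contains none of the groups $\Gamma(a)$, $a\ge 1$. (2) If moreover $\Gamma\subset\mathrm{SL}_2(\mathbb{Z})$, then the congruence kernel $C(\Gamma)$ is infinite. Here $C(\Gamma)$ is the kernel of the canonical homomorphism $\hat\Gamma\to\tilde\Gamma$, where $\hat\Gamma=\varprojlim_N \Gamma/N$, with $N$ running over all normal subgroups of finite index in $\Gamma$, and $\tilde\Gamma=\varprojlim_{a\ge 1}\Gamma/\Gamma(a)$. -/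

import Mathlib

open scoped MatrixGroups

/-- A linear algebraic group over `ℚ`: a subgroup of `GL_N(ℂ)` that is the zero locus of finitely
many polynomials with rational coefficients in the matrix entries `x_{ij}` (the variables
`some (i, j)`) and the inverse `u` of the determinant (the variable `none`). -/
structure LinearAlgebraicGroup (N : ℕ) where
  /-- the underlying subgroup of `GL_N(ℂ)` -/
  carrier : Subgroup (GL (Fin N) ℂ)
  exists_equations : ∃ P : Finset (MvPolynomial (Option (Fin N × Fin N)) ℚ),
    ∀ g : GL (Fin N) ℂ, g ∈ carrier ↔ ∀ p ∈ P,
      MvPolynomial.aeval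
        (fun v : Option (Fin N × Fin N) =>
          v.elim ((g : Matrix (Fin N) (Fin N) ℂ).det)⁻¹ (fun ij => g ij.1 ij.2)) p = 0

/-- The inclusion `GL_N(ℤ) → GL_N(ℂ)`. -/
noncomputable def intToComplexGL (N : ℕ) : GL (Fin N) ℤ →* GL (Fin N) ℂ :=
  Matrix.GeneralLinearGroup.map (Int.castRingHom ℂ)

/-- `GL_N(ℤ)` as a subgroup of `GL_N(ℂ)`. -/
noncomputable def integralGL (N : ℕ) : Subgroup (GL (Fin N) ℂ) := (intToComplexGL N).range

/-- `GL_N(ℚ)` as a subgroup of `GL_N(ℂ)`. -/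
noncomputable def rationalGL (N : ℕ) : Subgroup (GL (Fin N) ℂ) :=
  (Matrix.GeneralLinearGroup.map (n := Fin N) (algebraMap ℚ ℂ)).range

/-- The group `G(ℚ) = G ∩ GL_N(ℚ)` of rational points. -/
noncomputable def LinearAlgebraicGroup.rationalPoints {N : ℕ} (G : LinearAlgebraicGroup N) :
    Subgroup (GL (Fin N) ℂ) := G.carrier ⊓ rationalGL N

/-- The group `G ∩ GL_N(ℤ)`. -/
noncomputable def LinearAlgebraicGroup.integralPoints {N : ℕ} (G : LinearAlgebraicGroup N) :
    Subgroup (GL (Fin N) ℂ) := G.carrier ⊓ integralGL N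

/-- An arithmetic subgroup of `G` is a subgroup of `G(ℚ)` commensurable with `G ∩ GL_N(ℤ)`. -/
def LinearAlgebraicGroup.IsArithmetic {N : ℕ} (G : LinearAlgebraicGroup N)
    (Γ : Subgroup (GL (Fin N) ℂ)) : Prop :=
  Γ ≤ G.rationalPoints ∧ Subgroup.Commensurable Γ G.integralPoints

/-- The linear algebraic group `SL_N`, embedded in `GL_N` in the standard way. -/
noncomputable def specialLinear (N : ℕ) : LinearAlgebraicGroup N where
  carrier := (Matrix.GeneralLinearGroup.det : GL (Fin N) ℂ →* ℂˣ).ker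
  exists_equations := by
    refine ⟨{MvPolynomial.X none - 1}, fun g => ?_⟩
    simp [MonoidHom.mem_ker, Units.ext_iff, sub_eq_zero]

/-- The matrices of `GL_N(ℤ)` congruent to the identity modulo `a`, inside `GL_N(ℂ)`. -/
noncomputable def principalCongruenceGL (N : ℕ) (a : ℕ+) : Subgroup (GL (Fin N) ℂ) :=
  (Matrix.GeneralLinearGroup.map (n := Fin N) (Int.castRingHom (ZMod a))).ker.map
    (intToComplexGL N)

/-- The congruence subgroup `Γ(a)`, `a ≥ 1`, of `Γ`: the matrices in `Γ ∩ GL_N(ℤ)` which are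
congruent to the identity modulo `a`. -/
noncomputable def congruenceSubgroup {N : ℕ} (Γ : Subgroup (GL (Fin N) ℂ)) (a : ℕ+) : Subgroup Γ :=
  (principalCongruenceGL N a).subgroupOf Γ

/-- The property (CS), for an arithmetic subgroup `Γ` of a linear algebraic group: every subgroup
of finite index in `Γ` contains a congruence subgroup `Γ(a)`. -/
def SatisfiesCS {N : ℕ} (Γ : Subgroup (GL (Fin N) ℂ)) : Prop :=
  ∀ Γ' : Subgroup Γ, Γ'.FiniteIndex → ∃ a : ℕ+, congruenceSubgroup Γ a ≤ Γ'

/-- The projective limit of the quotients `G ⧸ K i`, for a family `K` of normal subgroups of finite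
index: the families of elements `x i` of `G ⧸ K i` which are compatible with all the canonical
projections `G ⧸ K j → G ⧸ K i` for `K j ⊆ K i`. -/
def quotientLimit {G : Type*} [Group G] {ι : Type*} (K : ι → FiniteIndexNormalSubgroup G) :
    Subgroup (∀ i, G ⧸ (K i).toSubgroup) where
  carrier := {x | ∀ i j, ∀ h : (K j).toSubgroup ≤ (K i).toSubgroup,
    QuotientGroup.map (K j).toSubgroup (K i).toSubgroup (MonoidHom.id G) h (x j) = x i}
  one_mem' := fun i j h => map_one _
  mul_mem' := fun {x y} hx hy i j h => by
    rw [Pi.mul_apply, Pi.mul_apply, map_mul, hx i j h, hy i j h]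
  inv_mem' := fun {x} hx i j h => by
    rw [Pi.inv_apply, Pi.inv_apply, map_inv, hx i j h]

/-- The natural map from the limit over a family of subgroups to the limit over a subfamily. -/
def quotientLimitRestrict {G : Type*} [Group G] {ι κ : Type*}
    (K : ι → FiniteIndexNormalSubgroup G) (f : κ → ι) :
    quotientLimit K →* quotientLimit (fun k => K (f k)) where
  toFun x := ⟨fun k => x.1 (f k), fun i j h => x.2 (f i) (f j) h⟩
  map_one' := rfl
  map_mul' _ _ := rfl

/-- The profinite completion: the limit of the `G ⧸ M` over all normal subgroups `M` of finite
index. -/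
abbrev fullCompletion (G : Type*) [Group G] :
    Subgroup (∀ M : FiniteIndexNormalSubgroup G, G ⧸ M.toSubgroup) :=
  quotientLimit (fun M : FiniteIndexNormalSubgroup G => M)

theorem congruenceSubgroup_normal {N : ℕ} (Γ : Subgroup (GL (Fin N) ℂ))
    (hΓ : Γ ≤ integralGL N) (a : ℕ+) : (congruenceSubgroup Γ a).Normal := by
  refine ⟨?_⟩
  rintro ⟨x, hx⟩ h ⟨g, hg⟩
  rw [congruenceSubgroup, Subgroup.mem_subgroupOf] at h ⊢
  obtain ⟨y, hy, hyx⟩ := h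
  obtain ⟨z, rfl⟩ := hΓ hg
  refine ⟨z * y * z⁻¹, ?_, ?_⟩
  · exact (MonoidHom.normal_ker _).conj_mem y hy z
  · simp only [map_mul, map_inv, hyx]
    rfl

theorem congruenceSubgroup_finiteIndex {N : ℕ} (Γ : Subgroup (GL (Fin N) ℂ))
    (hΓ : Γ ≤ integralGL N) (a : ℕ+) : (congruenceSubgroup Γ a).FiniteIndex := by
  have key : (principalCongruenceGL N a).relIndex (integralGL N) ≠ 0 := by
    rw [principalCongruenceGL, integralGL, MonoidHom.range_eq_map, ← Subgroup.relIndex_comap,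
      Subgroup.relIndex_top_right]
    exact (Subgroup.finiteIndex_of_le (Subgroup.le_comap_map (intToComplexGL N)
      (Matrix.GeneralLinearGroup.map (n := Fin N) (Int.castRingHom (ZMod a))).ker)).index_ne_zero
  exact ⟨fun h => key (Subgroup.relIndex_eq_zero_of_le_right hΓ h)⟩

/-- For `Γ ⊆ GL_N(ℤ)` the congruence subgroup `Γ(a)`, as a normal subgroup of finite index. -/
noncomputable def congruenceNormalSubgroup {N : ℕ} (Γ : Subgroup (GL (Fin N) ℂ))
    (hΓ : Γ ≤ integralGL N) (a : ℕ+) : FiniteIndexNormalSubgroup Γ where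
  toSubgroup := congruenceSubgroup Γ a
  isNormal' := congruenceSubgroup_normal Γ hΓ a
  isFiniteIndex' := congruenceSubgroup_finiteIndex Γ hΓ a

/-- The congruence completion: the limit of the `Γ ⧸ Γ(a)` over all congruence subgroups `Γ(a)`,
`a ≥ 1`. -/
noncomputable abbrev congruenceCompletion {N : ℕ} (Γ : Subgroup (GL (Fin N) ℂ)) (hΓ : Γ ≤ integralGL N) :
    Subgroup (∀ a : ℕ+, Γ ⧸ (congruenceNormalSubgroup Γ hΓ a).toSubgroup) :=
  quotientLimit (congruenceNormalSubgroup Γ hΓ)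

/-- The canonical map from the profinite completion of `Γ` to its congruence completion. -/
noncomputable def completionMap {N : ℕ} (Γ : Subgroup (GL (Fin N) ℂ)) (hΓ : Γ ≤ integralGL N) :
    fullCompletion Γ →* congruenceCompletion Γ hΓ :=
  quotientLimitRestrict (fun M : FiniteIndexNormalSubgroup Γ => M) (congruenceNormalSubgroup Γ hΓ)

/-- The congruence kernel `C(Γ)`. -/
noncomputable def congruenceKernel {N : ℕ} (Γ : Subgroup (GL (Fin N) ℂ)) (hΓ : Γ ≤ integralGL N) :
    Subgroup (fullCompletion Γ) :=
  (completionMap Γ hΓ).ker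

/-! `SL(2, ℤ)` has too many finite quotients. Modulo `±1` it is the free product of cyclic groups of
orders 2 and 3 generated by `S` and `S * T`, so it acts on `(ℤ/(12n+1))²` by affine maps with `T` of
order dividing 6 and `S * T ^ 3` a translation (`exists_hom_affine`). A normal subgroup containing
`T ^ 6` and some `Γ(a)` contains every matrix congruent to 1 modulo 6 (`mem_of_dvd_six`). Hence,
modulo the kernel of the action, some element of `Γ(a)` equals `(S * T ^ 3) ^ 12`, and its first `n`
powers act nontrivially. Taking `n` to be the index of `Γ ∩ SL(2, ℤ)` in `SL(2, ℤ)` refutes (CS) for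
`Γ`.

If the congruence kernel were finite, a finite-index `Δ ≤ Γ` would separate its elements from 1. As
`Δ` is again arithmetic, (CS) fails for it, and an ultralimit of witnesses is a nontrivial kernel
element that dies in those separating quotients. -/

/-! ### Homomorphisms out of the modular group. -/

/-- The homomorphism `ℤ/n → G` sending the generator to an element `g` with `g ^ n = 1`. -/
noncomputable def cyclicLift {G : Type*} [Group G] (n : ℕ) (g : G) (h : g ^ n = 1) :
    Multiplicative (ZMod n) →* G :=
  AddMonoidHom.toMultiplicativeLeft
    (ZMod.lift n ⟨zmultiplesHom (Additive G) (Additive.ofMul g), by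
      simpa using congrArg Additive.ofMul h⟩)

theorem cyclicLift_intCast {G : Type*} [Group G] (n : ℕ) (g : G) (h : g ^ n = 1) (j : ℤ) :
    cyclicLift n g h (Multiplicative.ofAdd (j : ZMod n)) = g ^ j := by
  change Additive.toMul (ZMod.lift n _ (j : ZMod n)) = g ^ j
  simp [ZMod.lift_coe]

/-- The action of `SL(2, ℤ)` on the projective line over `ℚ`. -/
noncomputable def modularPerm : SL(2, ℤ) →* Equiv.Perm (OnePoint ℚ) :=
  (MulAction.toPermHom (GL (Fin 2) ℚ) (OnePoint ℚ)).comp (Matrix.SpecialLinearGroup.mapGL ℚ)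

theorem modularPerm_coe (g : SL(2, ℤ)) (x : ℚ) :
    modularPerm g (x : OnePoint ℚ) =
      if (g 1 0 : ℚ) * x + g 1 1 = 0 then OnePoint.infty
      else (((g 0 0 : ℚ) * x + g 0 1) / (g 1 0 * x + g 1 1) : ℚ) := by
  simp [modularPerm, OnePoint.smul_some_eq_ite]

theorem modularPerm_of_coe_eq (g : SL(2, ℤ)) {a b c d : ℤ}
    (h : (g : Matrix (Fin 2) (Fin 2) ℤ) = !![a, b; c, d]) (x : ℚ) (hx : (c : ℚ) * x + d ≠ 0) :
    modularPerm g (x : OnePoint ℚ) = (((a : ℚ) * x + b) / (c * x + d) : ℚ) := by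
  rw [modularPerm_coe, h]
  simp [hx]

theorem modularPerm_neg_one : modularPerm (-1) = 1 := by
  ext1 x
  cases x with
  | infty => simp [modularPerm, OnePoint.smul_infty_eq_ite]
  | coe x => simp [modularPerm_coe]

theorem modularPerm_S_sq : modularPerm ModularGroup.S ^ 2 = 1 := by
  rw [← map_pow, ← modularPerm_neg_one]
  congr 1
  ext i j
  fin_cases i <;> fin_cases j <;> decide

theorem modularPerm_S_mul_T_pow_three :
    modularPerm (ModularGroup.S * ModularGroup.T) ^ 3 = 1 := by
  rw [← map_pow, ← modularPerm_neg_one]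
  congr 1
  ext i j
  fin_cases i <;> fin_cases j <;> decide

/-- The exponents of the generators `S` and `S * T` of the modular group. -/
abbrev modularExponent (i : Bool) : ℕ := cond i 3 2

/-- The free product of cyclic groups of orders `2` and `3`. -/
abbrev FreeProductTwoThree : Type :=
  Monoid.CoprodI fun i : Bool => Multiplicative (ZMod (modularExponent i))

/-- The homomorphism from the free product of cyclic groups of orders `2` and `3` given by an
element killed by `2` and an element killed by `3`. -/
noncomputable def freeProductLift {P : Type*} [Group P] (s u : P) (hs : s ^ 2 = 1) (hu : u ^ 3 = 1) :
    FreeProductTwoThree →* P :=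
  Monoid.CoprodI.lift fun i => match i with
    | false => cyclicLift 2 s hs
    | true => cyclicLift 3 u hu

/-- Ping-pong on the rational line: `S` sends negative numbers to positive ones, while `S * T` and
its square send positive numbers to negative ones. -/
theorem freeProductLift_injective :
    Function.Injective (freeProductLift _ _ modularPerm_S_sq modularPerm_S_mul_T_pow_three) := by
  refine Monoid.CoprodI.lift_injective_of_ping_pong (α := OnePoint ℚ) _
    (Or.inr ⟨true, by simp [modularExponent]⟩)
    (fun i => cond i {y | ∃ x : ℚ, x < 0 ∧ y = x} {y | ∃ x : ℚ, 0 < x ∧ y = x}) ?_ ?_ ?_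
  · rintro (_ | _)
    · exact ⟨_, 1, by norm_num, rfl⟩
    · exact ⟨_, -1, by norm_num, rfl⟩
  · have key : ∀ y : OnePoint ℚ, (∃ x : ℚ, x < 0 ∧ y = x) → (∃ x : ℚ, 0 < x ∧ y = x) → False := by
      rintro _ ⟨x, hx, rfl⟩ ⟨z, hz, h⟩
      have := OnePoint.coe_injective h
      linarith
    rintro (_ | _) (_ | _) hij
    · exact absurd rfl hij
    · exact Set.disjoint_left.2 fun y h h' => key y h' h
    · exact Set.disjoint_left.2 fun y h h' => key y h h'
    · exact absurd rfl hij
  · have hS : ∀ x : ℚ, x < 0 → ∃ z : ℚ, 0 < z ∧ modularPerm ModularGroup.S x = z := by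
      intro x hx
      refine ⟨-1 / x, div_pos_of_neg_of_neg (by norm_num) hx, ?_⟩
      rw [modularPerm_of_coe_eq _ ModularGroup.coe_S _ (by simpa using hx.ne)]
      simp
    have hU : ∀ x : ℚ, 0 < x → ∃ z : ℚ, z < 0 ∧
        modularPerm (ModularGroup.S * ModularGroup.T) x = z := by
      intro x hx
      refine ⟨-1 / (x + 1), div_neg_of_neg_of_pos (by norm_num) (by positivity), ?_⟩
      have : x + 1 ≠ 0 := by positivity
      rw [modularPerm_of_coe_eq (a := 0) (b := -1) (c := 1) (d := 1) _ (by decide) _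
        (by simpa using this)]
      simp
    have hU' : ∀ x : ℚ, 0 < x → ∃ z : ℚ, z < 0 ∧
        modularPerm ((ModularGroup.S * ModularGroup.T) ^ 2) x = z := by
      intro x hx
      refine ⟨-(x + 1) / x, div_neg_of_neg_of_pos (by linarith) hx, ?_⟩
      rw [modularPerm_of_coe_eq (a := -1) (b := -1) (c := 1) (d := 0) _ (by decide) _
        (by simpa using hx.ne')]
      congr 1
      simp
      ring
    rintro (_ | _) (_ | _) hij
    · exact absurd rfl hij
    · intro h hh
      obtain ⟨j, rfl⟩ := Multiplicative.ofAdd.surjective h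
      have hj : j = ((1 : ℤ) : ZMod 2) := by
        revert j
        change ∀ j : ZMod 2, j ≠ 0 → _
        decide
      rintro _ ⟨_, ⟨x, hx, rfl⟩, rfl⟩
      subst hj
      change ∃ z : ℚ, 0 < z ∧ cyclicLift 2 _ modularPerm_S_sq _ (x : OnePoint ℚ) = z
      rw [cyclicLift_intCast, zpow_one]
      exact hS x hx
    · intro h hh
      obtain ⟨j, rfl⟩ := Multiplicative.ofAdd.surjective h
      have hj : j = ((1 : ℤ) : ZMod 3) ∨ j = ((2 : ℤ) : ZMod 3) := by
        revert j
        change ∀ j : ZMod 3, j ≠ 0 → _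
        decide
      rintro _ ⟨_, ⟨x, hx, rfl⟩, rfl⟩
      change ∃ z : ℚ, z < 0 ∧
        cyclicLift 3 _ modularPerm_S_mul_T_pow_three _ (x : OnePoint ℚ) = z
      rcases hj with rfl | rfl
      · rw [cyclicLift_intCast, zpow_one]
        exact hU x hx
      · rw [cyclicLift_intCast, ← map_zpow]
        exact hU' x hx
    · exact absurd rfl hij

theorem freeProductLift_S {P : Type*} [Group P] (s u : P) (hs : s ^ 2 = 1) (hu : u ^ 3 = 1) :
    freeProductLift s u hs hu
      (Monoid.CoprodI.of (i := false) (Multiplicative.ofAdd ((1 : ℤ) : ZMod 2))) = s := by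
  rw [freeProductLift, Monoid.CoprodI.lift_of]
  exact (cyclicLift_intCast 2 s hs 1).trans (zpow_one s)

theorem freeProductLift_U {P : Type*} [Group P] (s u : P) (hs : s ^ 2 = 1) (hu : u ^ 3 = 1) :
    freeProductLift s u hs hu
      (Monoid.CoprodI.of (i := true) (Multiplicative.ofAdd ((1 : ℤ) : ZMod 3))) = u := by
  rw [freeProductLift, Monoid.CoprodI.lift_of]
  exact (cyclicLift_intCast 3 u hu 1).trans (zpow_one u)

/-- The image of `SL(2, ℤ)` in the permutations of the projective line is generated by `S` and `S *
T`, so it lies in the range of the injective `F`. Inverting `F` there maps `SL(2, ℤ)` to the free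
product, whose universal property gives the rest. -/
theorem exists_modular_hom {P : Type*} [Group P] (s u : P) (hs : s ^ 2 = 1) (hu : u ^ 3 = 1) :
    ∃ ρ : SL(2, ℤ) →* P,
      ρ ModularGroup.S = s ∧ ρ (ModularGroup.S * ModularGroup.T) = u := by
  set F := freeProductLift _ _ modularPerm_S_sq modularPerm_S_mul_T_pow_three with hF
  have hFS := freeProductLift_S _ _ modularPerm_S_sq modularPerm_S_mul_T_pow_three
  have hFU := freeProductLift_U _ _ modularPerm_S_sq modularPerm_S_mul_T_pow_three
  rw [← hF] at hFS hFU
  have hS : modularPerm ModularGroup.S ∈ F.range := ⟨_, hFS⟩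
  have hU : modularPerm (ModularGroup.S * ModularGroup.T) ∈ F.range := ⟨_, hFU⟩
  have hT : modularPerm ModularGroup.T ∈ F.range := by
    have := F.range.mul_mem (F.range.inv_mem hS) hU
    rwa [← map_inv, ← map_mul, inv_mul_cancel_left] at this
  have hmem : ∀ g, modularPerm g ∈ F.range := by
    have : (⊤ : Subgroup SL(2, ℤ)) ≤ F.range.comap modularPerm := by
      rw [← SpecialLinearGroup.SL2Z_generators, Subgroup.closure_le]
      rintro _ (rfl | rfl)
      exacts [hS, hT]
    exact fun g => this trivial
  let e := MonoidHom.ofInjective freeProductLift_injective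
  let σ : SL(2, ℤ) →* FreeProductTwoThree :=
    e.symm.toMonoidHom.comp (modularPerm.codRestrict F.range hmem)
  have hσ : ∀ g w, F w = modularPerm g → σ g = w := by
    intro g w h
    change e.symm _ = w
    rw [MulEquiv.symm_apply_eq]
    exact Subtype.ext h.symm
  refine ⟨(freeProductLift s u hs hu).comp σ, ?_, ?_⟩
  · rw [MonoidHom.comp_apply, hσ _ _ hFS, freeProductLift_S]
  · rw [MonoidHom.comp_apply, hσ _ _ hFU, freeProductLift_U]

/-! ### Finite affine quotients of the modular group. -/

/-- The translation by `(1, 0)` composed with the half turn. -/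
def affineHalfTurn (R : Type*) [CommRing R] : Equiv.Perm (R × R) where
  toFun p := (1 - p.1, -p.2)
  invFun p := (1 - p.1, -p.2)
  left_inv p := by simp
  right_inv p := by simp

/-- A linear automorphism of order six of `R × R`. -/
def rotationOfOrderSix (R : Type*) [CommRing R] : Equiv.Perm (R × R) where
  toFun p := (-p.2, p.1 + p.2)
  invFun p := (p.1 + p.2, -p.1)
  left_inv p := by simp
  right_inv p := by simp

/-- The group `SL(2, ℤ)` acts on `R × R` through the Euclidean triangle group `(2, 3, 6)`. -/
theorem exists_hom_affine (R : Type*) [CommRing R] :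
    ∃ ρ : SL(2, ℤ) →* Equiv.Perm (R × R),
      ρ ModularGroup.S = affineHalfTurn R ∧ ρ ModularGroup.T = rotationOfOrderSix R := by
  -- The linear part `A` of the product satisfies `1 + A + A² = 0`, so its cube is trivial whatever
  -- the translation part.
  obtain ⟨ρ, hS, hU⟩ := exists_modular_hom (affineHalfTurn R)
    (affineHalfTurn R * rotationOfOrderSix R)
    (by ext p <;> simp [pow_two, affineHalfTurn])
    (by
      ext p <;> simp only [pow_succ, pow_zero, one_mul, Equiv.Perm.mul_apply, affineHalfTurn,
        rotationOfOrderSix, Equiv.coe_fn_mk, Equiv.Perm.one_apply] <;> ring)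
  refine ⟨ρ, hS, ?_⟩
  rwa [map_mul, hS, mul_right_inj] at hU

theorem rotationOfOrderSix_pow (R : Type*) [CommRing R] : rotationOfOrderSix R ^ 6 = 1 := by
  ext p <;> simp only [pow_succ, pow_zero, one_mul, Equiv.Perm.mul_apply,
        rotationOfOrderSix, Equiv.coe_fn_mk, Equiv.Perm.one_apply] <;> ring

/-- The cube of the rotation is `-1`, which cancels the linear part of the half turn and leaves a
translation. -/
theorem affineHalfTurn_mul_pow_apply (R : Type*) [CommRing R] (m : ℕ) (p : R × R) :
    ((affineHalfTurn R * rotationOfOrderSix R ^ 3) ^ m) p = (p.1 + m, p.2) := by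
  have h : ∀ p : R × R, (affineHalfTurn R * rotationOfOrderSix R ^ 3) p = (p.1 + 1, p.2) := by
    intro p
    ext <;> simp only [pow_succ, pow_zero, one_mul, Equiv.Perm.mul_apply, affineHalfTurn,
        rotationOfOrderSix, Equiv.coe_fn_mk] <;> ring
  induction m generalizing p with
  | zero => simp
  | succ m ih =>
    rw [pow_succ, Equiv.Perm.mul_apply, h, ih]
    ext <;> push_cast <;> ring

/-! ### Matrices congruent to 1 modulo 6. -/

/-- The lower unipotent matrix with parameter `v`. -/
def lowerUnipotent (v : ℤ) : SL(2, ℤ) := ⟨!![1, 0; v, 1], by simp⟩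

theorem lowerUnipotent_eq_conj (v : ℤ) :
    lowerUnipotent v = ModularGroup.S * ModularGroup.T ^ (-v) * ModularGroup.S⁻¹ := by
  rw [eq_mul_inv_iff_mul_eq]
  ext i j
  rw [Matrix.SpecialLinearGroup.coe_mul, Matrix.SpecialLinearGroup.coe_mul,
    ModularGroup.coe_T_zpow, ModularGroup.coe_S, lowerUnipotent]
  fin_cases i <;> fin_cases j <;> simp

theorem T_zpow_mem {N : Subgroup SL(2, ℤ)} (hT : ModularGroup.T ^ 6 ∈ N) {v : ℤ} (hv : 6 ∣ v) :
    ModularGroup.T ^ v ∈ N := by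
  obtain ⟨c, rfl⟩ := hv
  rw [zpow_mul]
  exact N.zpow_mem hT c

theorem lowerUnipotent_mem {N : Subgroup SL(2, ℤ)} [N.Normal] (hT : ModularGroup.T ^ 6 ∈ N) {v : ℤ}
    (hv : 6 ∣ v) : lowerUnipotent v ∈ N := by
  rw [lowerUnipotent_eq_conj]
  exact Subgroup.Normal.conj_mem inferInstance _ (T_zpow_mem hT (hv.neg_right)) _

theorem lowerUnipotent_neg (v : ℤ) : lowerUnipotent (-v) = (lowerUnipotent v)⁻¹ := by
  rw [lowerUnipotent_eq_conj, lowerUnipotent_eq_conj, neg_neg, conj_inv, ← zpow_neg, neg_neg]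

/-- Gaussian elimination with pivot `x`: the matrix is lower unipotent times `diag(x, v)` times
upper unipotent, and the middle factors multiply to `diag(x, v)`. Up to conjugation every parameter
is a multiple of `x - 1`, `y` or `z`, hence of 6 in the application. -/
theorem unipotent_factorization {R : Type*} [CommRing R] {x y z w v : R} (hv : v * x = 1)
    (hdet : x * w - y * z = 1) :
    !![1, 0; z * v, 1] * (!![1, 0; -v, 1] * !![1, x - 1; 0, 1] * !![1, 0; v, 1]) *
      !![1, 0; (x - 1) * v, 1] * !![1, -((x - 1) * v); 0, 1] * !![1, v * y; 0, 1] =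
      !![x, y; z, w] := by
  simp only [Matrix.mul_fin_two]
  congr! 4 <;> grind

/-- A matrix congruent to `1` modulo `6` whose upper left entry is prime to `a` is, modulo `a`, a
product of conjugates of sixth powers of unipotent matrices. -/
theorem mem_of_isCoprime {N : Subgroup SL(2, ℤ)} [N.Normal] (hT : ModularGroup.T ^ 6 ∈ N) {a : ℕ}
    (ha : CongruenceSubgroup.Gamma a ≤ N) {g : SL(2, ℤ)} (h00 : 6 ∣ g 0 0 - 1) (h01 : 6 ∣ g 0 1)
    (h10 : 6 ∣ g 1 0) (hg : IsCoprime (g 0 0) (a : ℤ)) : g ∈ N := by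
  obtain ⟨v, u, huv⟩ := hg
  have hdet := g.det_coe
  rw [Matrix.det_fin_two] at hdet
  set s := g 0 0 - 1 with hs
  set P : SL(2, ℤ) := lowerUnipotent (g 1 0 * v) *
    (lowerUnipotent (-v) * ModularGroup.T ^ s * (lowerUnipotent (-v))⁻¹) *
    lowerUnipotent (s * v) * ModularGroup.T ^ (-(s * v)) * ModularGroup.T ^ (v * g 0 1) with hP
  have hPN : P ∈ N := by
    refine N.mul_mem (N.mul_mem (N.mul_mem (N.mul_mem ?_ ?_) ?_) ?_) ?_
    · exact lowerUnipotent_mem hT (h10.mul_right _)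
    · exact Subgroup.Normal.conj_mem inferInstance _ (T_zpow_mem hT h00) _
    · exact lowerUnipotent_mem hT (h00.mul_right _)
    · exact T_zpow_mem hT (h00.mul_right _).neg_right
    · exact T_zpow_mem hT (h01.mul_left _)
  have hmap : Matrix.SpecialLinearGroup.map (Int.castRingHom (ZMod a)) P =
      Matrix.SpecialLinearGroup.map (Int.castRingHom (ZMod a)) g := by
    have h1 : ((v : ZMod a)) * (g 0 0 : ℤ) = 1 := by
      have := congrArg (Int.cast : ℤ → ZMod a) huv
      push_cast at this
      simpa using this
    have h2 : ((g 0 0 : ℤ) : ZMod a) * (g 1 1 : ℤ) - (g 0 1 : ℤ) * (g 1 0 : ℤ) = 1 := by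
      have := congrArg (Int.cast : ℤ → ZMod a) hdet
      push_cast at this
      exact this
    have hPcoe : (P : Matrix (Fin 2) (Fin 2) ℤ) = !![1, 0; g 1 0 * v, 1] *
        (!![1, 0; -v, 1] * !![1, s; 0, 1] * !![1, 0; v, 1]) *
        !![1, 0; s * v, 1] * !![1, -(s * v); 0, 1] * !![1, v * g 0 1; 0, 1] := by
      rw [hP, lowerUnipotent_neg, inv_inv, ← lowerUnipotent_neg]
      simp only [Matrix.SpecialLinearGroup.coe_mul, ModularGroup.coe_T_zpow]
      rfl
    have hgcoe : (Int.castRingHom (ZMod a)).mapMatrix (g : Matrix (Fin 2) (Fin 2) ℤ) =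
        !![((g 0 0 : ℤ) : ZMod a), (g 0 1 : ℤ); (g 1 0 : ℤ), (g 1 1 : ℤ)] := by
      ext i j
      fin_cases i <;> fin_cases j <;> rfl
    apply Subtype.ext
    change (Int.castRingHom (ZMod a)).mapMatrix (P : Matrix (Fin 2) (Fin 2) ℤ) =
      (Int.castRingHom (ZMod a)).mapMatrix (g : Matrix (Fin 2) (Fin 2) ℤ)
    rw [hgcoe, hPcoe, ← unipotent_factorization h1 h2]
    have hm : ∀ p q r t : ℤ, (Int.castRingHom (ZMod a)).mapMatrix !![p, q; r, t] =
        !![(p : ZMod a), (q : ZMod a); (r : ZMod a), (t : ZMod a)] := by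
      intro p q r t
      ext i j
      fin_cases i <;> fin_cases j <;> rfl
    simp only [map_mul, hm, hs]
    push_cast
    rfl
  have hmem : P⁻¹ * g ∈ CongruenceSubgroup.Gamma a := by
    rw [CongruenceSubgroup.Gamma, MonoidHom.mem_ker, map_mul, map_inv, hmap, inv_mul_cancel]
  simpa using N.mul_mem hPN (ha hmem)

/-- Right multiplication by `lowerUnipotent (6 * j)` moves the upper left entry along an arithmetic
progression of difference `6 * g 0 1`. By Dirichlet it can be made a prime larger than `a`, hence
prime to `a`. -/
theorem mem_of_dvd_six {N : Subgroup SL(2, ℤ)} [N.Normal] (hT : ModularGroup.T ^ 6 ∈ N) {a : ℕ}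
    (ha0 : a ≠ 0) (ha : CongruenceSubgroup.Gamma a ≤ N) {g : SL(2, ℤ)} (h00 : 6 ∣ g 0 0 - 1)
    (h01 : 6 ∣ g 0 1) (h10 : 6 ∣ g 1 0) : g ∈ N := by
  have hdet := g.det_coe
  rw [Matrix.det_fin_two] at hdet
  -- Here the progression is constant, but the upper left entry is already a unit.
  by_cases hy : g 0 1 = 0
  · refine mem_of_isCoprime hT ha h00 h01 h10 ?_
    rw [hy, zero_mul, sub_zero] at hdet
    exact ⟨g 1 1, 0, by linarith⟩
  have hcop : IsCoprime (g 0 0) ((6 * g 0 1).natAbs : ℤ) := by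
    rw [Int.natCast_natAbs, IsCoprime.abs_right_iff]
    obtain ⟨c, hc⟩ := h00
    exact IsCoprime.mul_right ⟨1, -c, by linarith⟩ ⟨g 1 1, -g 1 0, by linarith⟩
  obtain ⟨p, hpa, hp, hpx⟩ := Nat.forall_exists_prime_gt_and_zmodEq a
    (q := (6 * g 0 1).natAbs) (by simpa using hy) hcop
  obtain ⟨j, hj⟩ : 6 * g 0 1 ∣ p - g 0 0 := by
    rw [← Int.natAbs_dvd]
    exact hpx.symm.dvd
  have hL : lowerUnipotent (6 * j) ∈ N := lowerUnipotent_mem hT (dvd_mul_right _ _)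
  suffices g * lowerUnipotent (6 * j) ∈ N by
    simpa using N.mul_mem this (N.inv_mem hL)
  have hcoe : (g * lowerUnipotent (6 * j) : Matrix (Fin 2) (Fin 2) ℤ) =
      !![g 0 0 + g 0 1 * (6 * j), g 0 1; g 1 0 + g 1 1 * (6 * j), g 1 1] := by
    rw [Matrix.eta_fin_two (g : Matrix (Fin 2) (Fin 2) ℤ), lowerUnipotent]
    simp
  have e00 : (g * lowerUnipotent (6 * j)) 0 0 = p := by
    rw [Matrix.SpecialLinearGroup.coe_mul, hcoe]
    simp only [Matrix.of_apply, Matrix.cons_val_zero]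
    linarith
  refine mem_of_isCoprime hT ha ?_ ?_ ?_ ?_
  · rw [e00]
    have : (p : ℤ) - 1 = 6 * (g 0 1 * j) + (g 0 0 - 1) := by linarith
    rw [this]
    exact dvd_add (dvd_mul_right _ _) h00
  · rw [Matrix.SpecialLinearGroup.coe_mul, hcoe]
    exact h01
  · rw [Matrix.SpecialLinearGroup.coe_mul, hcoe]
    exact dvd_add h10 ((dvd_mul_right _ _).mul_left _)
  · rw [e00, Nat.isCoprime_iff_coprime]
    exact (Nat.Prime.coprime_iff_not_dvd hp).2 fun h => by
      have := Nat.le_of_dvd (Nat.pos_of_ne_zero ha0) h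
      omega

/-- The exponent is the order of `S * T ^ 3` modulo 6: it has order 3 modulo 2 and order 4 modulo 3.
-/
theorem dvd_translation_entries :
    let g := (ModularGroup.S * ModularGroup.T ^ 3) ^ 12
    6 ∣ g 0 0 - 1 ∧ 6 ∣ g 0 1 ∧ 6 ∣ g 1 0 := by
  decide

/-- For every `n` there is a subgroup of finite index of `SL(2, ℤ)` which no `Γ(a)` can meet in a
subgroup of index at most `n`. -/
theorem exists_finiteIndex_forall_pow_notMem (n : ℕ) :
    ∃ K : Subgroup SL(2, ℤ), K.FiniteIndex ∧ ∀ a : ℕ, a ≠ 0 →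
      ∃ γ ∈ CongruenceSubgroup.Gamma a, ∀ i, 0 < i → i ≤ n → γ ^ i ∉ K := by
  -- The modulus exceeds `12 * i` for all `i ≤ n`, so translation by `12 * i` is nontrivial for `0 <
  -- i ≤ n`.
  have : NeZero (12 * n + 1) := ⟨by omega⟩
  obtain ⟨ρ, hS, hT⟩ := exists_hom_affine (ZMod (12 * n + 1))
  refine ⟨ρ.ker, inferInstance, fun a ha => ?_⟩
  have hT6 : ModularGroup.T ^ 6 ∈ ρ.ker := by
    rw [MonoidHom.mem_ker, map_pow, hT, rotationOfOrderSix_pow]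
  obtain ⟨h00, h01, h10⟩ := dvd_translation_entries
  have : (CongruenceSubgroup.Gamma a).Normal := CongruenceSubgroup.Gamma_normal a
  have : (ρ.ker ⊔ CongruenceSubgroup.Gamma a).Normal := Subgroup.sup_normal _ _
  have hmem := mem_of_dvd_six (N := ρ.ker ⊔ CongruenceSubgroup.Gamma a)
    (Subgroup.mem_sup_left hT6) ha le_sup_right h00 h01 h10
  obtain ⟨m, hm, γ, hγ, hmγ⟩ := Subgroup.mem_sup_of_normal_left.1 hmem
  refine ⟨γ, hγ, fun i hi hin h => ?_⟩
  have hργ : ρ γ = (affineHalfTurn _ * rotationOfOrderSix _ ^ 3) ^ 12 := by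
    have := congrArg ρ hmγ
    rwa [map_mul, hm, one_mul, map_pow, map_mul, map_pow, hS, hT] at this
  rw [MonoidHom.mem_ker, map_pow, hργ, ← pow_mul] at h
  have h0 := congrArg Prod.fst (Equiv.ext_iff.1 h (0, 0))
  rw [affineHalfTurn_mul_pow_apply] at h0
  simp only [zero_add, Equiv.Perm.one_apply] at h0
  rw [ZMod.natCast_eq_zero_iff] at h0
  have := Nat.le_of_dvd (by omega) h0
  omega

/-! ### Failure of (CS) for arithmetic subgroups. -/

/-- The inclusion `SL(2, ℤ) → GL(2, ℂ)`. -/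
noncomputable def modularToComplexGL : SL(2, ℤ) →* GL (Fin 2) ℂ :=
  (intToComplexGL 2).comp Matrix.SpecialLinearGroup.toGL

theorem intToComplexGL_injective (N : ℕ) : Function.Injective (intToComplexGL N) :=
  fun _ _ h => Units.ext (Matrix.map_injective Int.cast_injective (congrArg Units.val h))

theorem modularToComplexGL_injective : Function.Injective modularToComplexGL :=
  (intToComplexGL_injective 2).comp Matrix.SpecialLinearGroup.toGL_injective

theorem integralPoints_specialLinear_two :
    (specialLinear 2).integralPoints = modularToComplexGL.range := by
  ext g
  constructor
  · rintro ⟨hg, z, rfl⟩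
    have hdet : (z : Matrix (Fin 2) (Fin 2) ℤ).det = 1 := by
      have h : Matrix.GeneralLinearGroup.det (intToComplexGL 2 z) = 1 := hg
      have h' := congrArg Units.val h
      rw [intToComplexGL, Matrix.GeneralLinearGroup.map_det] at h'
      exact Int.cast_injective (α := ℂ) (by simpa using h')
    exact ⟨⟨z, hdet⟩, congrArg (intToComplexGL 2) (Units.ext rfl)⟩
  · rintro ⟨g, rfl⟩
    refine ⟨?_, _, rfl⟩
    change Matrix.GeneralLinearGroup.det (intToComplexGL 2 _) = 1
    rw [intToComplexGL, Matrix.GeneralLinearGroup.map_det]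
    ext
    simp

theorem modularToComplexGL_mem_principalCongruenceGL (a : ℕ+) {g : SL(2, ℤ)}
    (hg : g ∈ CongruenceSubgroup.Gamma a) : modularToComplexGL g ∈ principalCongruenceGL 2 a := by
  refine ⟨_, ?_, rfl⟩
  have h : Matrix.SpecialLinearGroup.map (Int.castRingHom (ZMod a)) g = 1 := hg
  exact Units.ext (congrArg Subtype.val h)

/-- No arithmetic subgroup of `SL_2` has the congruence subgroup property. -/
theorem not_satisfiesCS_of_isArithmetic {Γ : Subgroup (GL (Fin 2) ℂ)}
    (hΓ : (specialLinear 2).IsArithmetic Γ) : ¬ SatisfiesCS Γ := by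
  intro hCS
  obtain ⟨-, h1, h2⟩ := hΓ
  rw [integralPoints_specialLinear_two] at h1 h2
  have hΔ : (Γ.comap modularToComplexGL).index ≠ 0 := by
    rwa [Subgroup.index_comap]
  obtain ⟨K, hK, hKa⟩ := exists_finiteIndex_forall_pow_notMem (Γ.comap modularToComplexGL).index
  have hKr : (K.map modularToComplexGL).relIndex modularToComplexGL.range ≠ 0 := by
    rw [MonoidHom.range_eq_map, Subgroup.relIndex_map_map_of_injective _ _
      modularToComplexGL_injective, Subgroup.relIndex_top_right]
    exact hK.index_ne_zero
  obtain ⟨a, ha⟩ := hCS ((K.map modularToComplexGL).subgroupOf Γ)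
    ⟨Subgroup.relIndex_ne_zero_trans hKr h2⟩
  obtain ⟨γ, hγ, hγK⟩ := hKa a a.ne_zero
  -- `γ` itself need not lie in `Γ`; by pigeonhole on cosets a positive power with exponent at most
  -- the index does.
  obtain ⟨i, hi, hin, hmem⟩ := Subgroup.exists_pow_mem_of_index_ne_zero hΔ γ
  have hcong : (⟨modularToComplexGL (γ ^ i), hmem⟩ : Γ) ∈ congruenceSubgroup Γ a :=
    modularToComplexGL_mem_principalCongruenceGL a (Subgroup.pow_mem _ hγ i)
  obtain ⟨k, hk, hki⟩ := ha hcong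
  exact hγK i hi hin (modularToComplexGL_injective hki ▸ hk)

/-! ### Infinitude of the congruence kernel. -/

theorem LinearAlgebraicGroup.IsArithmetic.map_subtype {N : ℕ} {G : LinearAlgebraicGroup N}
    {Γ : Subgroup (GL (Fin N) ℂ)} (hΓ : G.IsArithmetic Γ) (Δ : Subgroup Γ) [Δ.FiniteIndex] :
    G.IsArithmetic (Δ.map Γ.subtype) := by
  have hle : Δ.map Γ.subtype ≤ Γ := Subgroup.map_subtype_le Δ
  refine ⟨hle.trans hΓ.1, Subgroup.Commensurable.trans ⟨?_, ?_⟩ hΓ.2⟩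
  · rw [Subgroup.relIndex, Subgroup.subgroupOf, Subgroup.comap_map_eq_self_of_injective
      Γ.subtype_injective]
    exact Subgroup.FiniteIndex.index_ne_zero
  · rw [Subgroup.relIndex_eq_one.2 hle]
    exact one_ne_zero

theorem congruenceSubgroup_anti {N : ℕ} (Γ : Subgroup (GL (Fin N) ℂ)) {a b : ℕ+}
    (hab : (a : ℕ) ∣ b) : congruenceSubgroup Γ b ≤ congruenceSubgroup Γ a := by
  refine Subgroup.comap_mono (Subgroup.map_mono fun g hg => ?_)
  rw [MonoidHom.mem_ker] at hg ⊢
  have h := congrArg (Matrix.GeneralLinearGroup.map (n := Fin N) (ZMod.castHom hab (ZMod a))) hg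
  rwa [map_one, ← MonoidHom.comp_apply, ← Matrix.GeneralLinearGroup.map_comp,
    RingHom.ext_int ((ZMod.castHom hab (ZMod a)).comp (Int.castRingHom (ZMod b)))
      (Int.castRingHom (ZMod a))] at h

/-- The limit of a sequence of elements along an ultrafilter, in the profinite completion. -/
theorem exists_ultralimit {G ι : Type*} [Group G] (φ : Ultrafilter ι) (x : ι → G) :
    ∃ c : fullCompletion G, ∀ M : FiniteIndexNormalSubgroup G,
      ∀ᶠ i in (φ : Filter ι), QuotientGroup.mk' M.toSubgroup (x i) = c.1 M := by
  have h : ∀ M : FiniteIndexNormalSubgroup G, ∃ y : G ⧸ M.toSubgroup,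
      ∀ᶠ i in (φ : Filter ι), QuotientGroup.mk' M.toSubgroup (x i) = y := by
    intro M
    have : M.toSubgroup.FiniteIndex := M.isFiniteIndex'
    -- An ultrafilter on a finite quotient is principal, so the sequence is eventually constant
    -- there.
    obtain ⟨y, hy⟩ := (φ.map fun i => QuotientGroup.mk' M.toSubgroup (x i)).eq_pure_of_finite
    refine ⟨y, ?_⟩
    have : {y} ∈ (φ.map fun i => QuotientGroup.mk' M.toSubgroup (x i)) := by
      rw [hy]; exact rfl
    exact this
  choose c hc using h
  refine ⟨⟨c, fun M M' hMM' => ?_⟩, hc⟩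
  obtain ⟨i, hi, hi'⟩ := ((hc M).and (hc M')).exists
  rw [← hi, ← hi']
  rfl

theorem infinite_congruenceKernel {Γ : Subgroup (GL (Fin 2) ℂ)}
    (hΓ : (specialLinear 2).IsArithmetic Γ) (hZ : Γ ≤ integralGL 2) :
    Infinite (congruenceKernel Γ hZ) := by
  by_contra hinf
  have hfin : Finite (congruenceKernel Γ hZ) := not_infinite_iff_finite.1 hinf
  have hsep : ∀ c : congruenceKernel Γ hZ, ∃ M : FiniteIndexNormalSubgroup Γ,
      c ≠ 1 → c.1.1 M ≠ 1 := by
    intro c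
    by_contra! h
    -- The level 1 is arbitrary: any index supplies `c ≠ 1`.
    obtain ⟨hc, -⟩ := h (congruenceNormalSubgroup Γ hZ 1)
    exact hc (Subtype.ext (Subtype.ext (funext fun M => (h M).2)))
  choose M hM using hsep
  let Δ : Subgroup Γ := ⨅ c, (M c).toSubgroup
  have hΔfin : Δ.FiniteIndex := Subgroup.finiteIndex_iInf fun c => (M c).isFiniteIndex'
  have hΔ := not_satisfiesCS_of_isArithmetic (hΓ.map_subtype Δ)
  unfold SatisfiesCS at hΔ
  push Not at hΔ
  obtain ⟨K, hKfin, hK⟩ := hΔ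
  let e : Δ.map Γ.subtype →* Γ := Subgroup.inclusion (Subgroup.map_subtype_le Δ)
  have he : Function.Injective e := Subgroup.inclusion_injective _
  have hrange : e.range = Δ := by
    ext g
    constructor
    · rintro ⟨⟨_, ⟨d, hd, rfl⟩⟩, rfl⟩
      exact hd
    · exact fun hg => ⟨⟨g, g, hg, rfl⟩, rfl⟩
  have hKΓ : (K.map e).FiniteIndex := by
    refine ⟨?_⟩
    rw [← Subgroup.relIndex_mul_index (Subgroup.map_le_range e K), mul_ne_zero_iff]
    refine ⟨?_, by rw [hrange]; exact hΔfin.index_ne_zero⟩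
    rw [MonoidHom.range_eq_map, Subgroup.relIndex_map_map_of_injective _ _ he,
      Subgroup.relIndex_top_right]
    exact hKfin.index_ne_zero
  -- The level `n!` is divisible by each `a ≤ n`, so the sequence eventually lies in every `Γ(a)`.
  have hx : ∀ n : ℕ, ∃ d : Γ, d ∈ Δ ∧ d ∈ congruenceSubgroup Γ ⟨n.factorial, n.factorial_pos⟩ ∧
      d ∉ K.map e := by
    intro n
    obtain ⟨d, hd, hdK⟩ := SetLike.not_le_iff_exists.1 (hK ⟨n.factorial, n.factorial_pos⟩)
    refine ⟨e d, hrange.le ⟨d, rfl⟩, hd, ?_⟩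
    rintro ⟨k, hk, hkd⟩
    exact hdK (he hkd ▸ hk)
  choose x hxΔ hxc hxK using hx
  obtain ⟨c, hc⟩ := exists_ultralimit (Filter.hyperfilter ℕ) x
  have hcker : c ∈ congruenceKernel Γ hZ := by
    refine Subtype.ext (funext fun a => ?_)
    change c.1 (congruenceNormalSubgroup Γ hZ a) = 1
    have hge : ∀ᶠ n in (Filter.hyperfilter ℕ : Filter ℕ), (a : ℕ) ≤ n :=
      Filter.Eventually.filter_mono Nat.hyperfilter_le_atTop (Filter.eventually_ge_atTop _)
    obtain ⟨n, hn, han⟩ := ((hc (congruenceNormalSubgroup Γ hZ a)).and hge).exists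
    rw [← hn]
    refine (QuotientGroup.eq_one_iff _).2 ?_
    exact congruenceSubgroup_anti Γ (Nat.dvd_factorial a.pos han) (hxc n)
  have hcM : c.1 (M ⟨c, hcker⟩) = 1 := by
    obtain ⟨n, hn⟩ := (hc (M ⟨c, hcker⟩)).exists
    rw [← hn]
    exact (QuotientGroup.eq_one_iff _).2 ((iInf_le (fun c => (M c).toSubgroup) _) (hxΔ n))
  have hc1 : c = 1 := by
    by_contra hne
    exact hM ⟨c, hcker⟩ (fun h => hne (congrArg Subtype.val h)) hcM
  -- The completion only sees normal subgroups, hence the normal core; `c = 1` then forces some `x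
  -- n` into `K`.
  let L : FiniteIndexNormalSubgroup Γ :=
    { toSubgroup := (K.map e).normalCore
      isNormal' := inferInstance
      isFiniteIndex' := inferInstance }
  obtain ⟨n, hn⟩ := (hc L).exists
  rw [hc1] at hn
  exact hxK n (Subgroup.normalCore_le _ ((QuotientGroup.eq_one_iff (N := L.toSubgroup) _).1 hn))

/-- `SL_2` does not satisfy (CS), whatever the arithmetic subgroup `Γ ⊆ SL_2(ℚ)` it is tested on;
and the congruence kernel of every arithmetic subgroup `Γ ⊆ SL_2(ℤ)` is infinite. -/
theorem corollary18 (Γ : Subgroup (GL (Fin 2) ℂ)) (hΓ : (specialLinear 2).IsArithmetic Γ) :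
    ¬ SatisfiesCS Γ ∧ ∀ hZ : Γ ≤ integralGL 2, Infinite (congruenceKernel Γ hZ) :=
  ⟨not_satisfiesCS_of_isArithmetic hΓ, infinite_congruenceKernel hΓ⟩
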